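/- Let $X$ be a set with a countably generated $\sigma$-field $\mathcal B$, let $m=(m_x)_{x\in X}$ be a random walk on it (each $m_x$ is a probability measure on $\mathcal B$ and $x\mapsto m_x(A)$ is measurable for every $A\in\mathcal B$), and let $\nu$ be a $\sigma$-finite measure on $\mathcal B$ that is reversible for $m$, i.e. $dm_x(y)\,d\nu(x)=dm_y(x)\,d\nu(y)$. For $\Omega\in\mathcal B$ put $\partial_m\Omega=\{x\in X\setminus\Omega : m_x(\Omega)>0\}$ and $\Omega_m=\Omega\cup\partial_m\Omega$, and assume $0<\nu(\Omega)<\nu(\Omega_m)<\infty$. Write $\nabla f(x,y)=f(y)-f(x)$. Let $1<p<\infty$ and $L^p_0(\Omega_m,\nu)=\{f\in L^p(\Omega_m,\nu): f=0\ \nu\text{-a.e. on }\partial_m\Omega\}$. Assume that $\Omega$ satisfies a $p$-Poincaré inequality: there is $\lambda>0$ with $$\lambda\int_\Omega|f|^p\,d\nu\le\int_{\Omega_m\times\Omega_m}|\nabla f(x,y)|^p\,dm_x(y)\,d\nu(x)\qquad\text{for all } f\in L^p_0(\Omega_m,\nu).$$ Then the homogeneous Dirichlet problem $$-\int_{\Omega_m}|f(y)-f(x)|^{p-2}(f(y)-f(x))\,dm_x(y)=1\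 \text{ for }\nu\text{-a.e. }x\in\Omega,\qquad f=0\ \ \nu\text{-a.e. on }\partial_m\Omega,$$ has a unique solution $f_{\Omega,p}$ in $L^p_0(\Omega_m,\nu)$ (up to equality $\nu$-a.e. on $\Omega_m$), and $f_{\Omega,p}\ge0$. Moreover the integrals in $$\mathcal F_{m,p}(f)=\frac1{2p}\int_{\Omega_m\times\Omega_m}|\nabla f(x,y)|^p\,dm_x(y)\,d\nu(x)-\int_\Omega f\,d\nu$$ are finite for every $f\in L^p_0(\Omega_m,\nu)$; $f_{\Omega,p}\neq0$, and $f_{\Omega,p}$ is the only minimizer of $\mathcal F_{m,p}$ over $L^p_0(\Omega_m,\nu)$, hence also over $L^p_0(\Omega_m,\nu)\setminus\{0\}$. Finally, $$\int_\Omega f_{\Omega,p}\,d\nu=\frac12\int_{\Omega_m\times\Omega_m}|\nabla f_{\Omega,p}(x,y)|^p\,dm_x(y)\,d\nu(x).$$ -/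

import Mathlib

open MeasureTheory ProbabilityTheory

noncomputable section

namespace RandomWalkSpace

variable {X : Type*} [MeasurableSpace X]

/-- The `m`-boundary `∂_m Ω` of `Ω`: the points outside `Ω` that jump into `Ω` with positive
probability. -/
def mBoundary (m : Kernel X X) (Ω : Set X) : Set X :=
  {x | x ∉ Ω ∧ 0 < m x Ω}

/-- The `m`-closure `Ω_m = Ω ∪ ∂_m Ω`. -/
def mClosure (m : Kernel X X) (Ω : Set X) : Set X :=
  Ω ∪ mBoundary m Ω

/-- The nonlocal gradient `∇f (x, y) = f y - f x`. -/
def nlGrad (f : X → ℝ) (z : X × X) : ℝ :=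
  f z.2 - f z.1

/-- The space `L^p_0(Ω_m, ν)` of the (classes of) functions in `L^p(Ω_m, ν)` that vanish
`ν`-almost everywhere on `∂_m Ω`. -/
def Lp0 (m : Kernel X X) (ν : Measure X) (Ω : Set X) (p : ℝ) :
    Submodule ℝ (Lp ℝ (ENNReal.ofReal p) (ν.restrict (mClosure m Ω))) where
  carrier := {f | ∀ᵐ x ∂(ν.restrict (mBoundary m Ω)), f x = 0}
  zero_mem' := by
    have h := Lp.coeFn_zero ℝ (ENNReal.ofReal p) (ν.restrict (mClosure m Ω))
    filter_upwards [ae_restrict_of_ae_restrict_of_subset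
      (Set.subset_union_right : mBoundary m Ω ⊆ mClosure m Ω) h] with x hx
    simpa using hx
  add_mem' := by
    intro f g hf hg
    filter_upwards [hf, hg, ae_restrict_of_ae_restrict_of_subset
      (Set.subset_union_right : mBoundary m Ω ⊆ mClosure m Ω) (Lp.coeFn_add f g)]
      with x h1 h2 h3
    rw [h3, Pi.add_apply, h1, h2, add_zero]
  smul_mem' := by
    intro c f hf
    filter_upwards [hf, ae_restrict_of_ae_restrict_of_subset
      (Set.subset_union_right : mBoundary m Ω ⊆ mClosure m Ω) (Lp.coeFn_smul c f)]
      with x h1 h3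
    rw [h3, Pi.smul_apply, h1, smul_zero]

/-- The Dirichlet integral `∫_{Ω_m × Ω_m} |∇f(x, y)|^p d(ν ⊗ m_x)(x, y)`. -/
def dirichletIntegral (m : Kernel X X) (ν : Measure X) (Ω : Set X) (p : ℝ) (f : X → ℝ) : ℝ :=
  ∫ z in mClosure m Ω ×ˢ mClosure m Ω, |nlGrad f z| ^ p ∂(ν ⊗ₘ m)

/-- `Ω` satisfies a `p`-Poincaré inequality. -/
def PoincareInequality (m : Kernel X X) (ν : Measure X) (Ω : Set X) (p : ℝ) : Prop :=
  ∃ c : ℝ, 0 < c ∧ ∀ f ∈ Lp0 m ν Ω p,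
    c * ∫ x in Ω, |f x| ^ p ∂ν ≤ dirichletIntegral m ν Ω p f

/-- The integrand `|∇f|^{p-2} ∇f` of the `m`-`p`-Laplacian. Where `∇f = 0` its value is `0`,
also for `p < 2`. -/
def pFlux (p : ℝ) (f : X → ℝ) (x y : X) : ℝ :=
  |nlGrad f (x, y)| ^ (p - 2) * nlGrad f (x, y)

/-- `f` is a solution of the homogeneous Dirichlet problem `-Δ_{m,p} f = g` in `Ω`, `f = 0` on
`∂_m Ω`, where `Δ_{m,p} f (x) = ∫_{Ω_m} |f y - f x|^{p-2} (f y - f x) dm_x(y)`.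
The equations hold `ν`-almost everywhere. -/
def IsDirichletSolution (m : Kernel X X) (ν : Measure X) (Ω : Set X) (p : ℝ) (g : X → ℝ)
    (f : Lp ℝ (ENNReal.ofReal p) (ν.restrict (mClosure m Ω))) : Prop :=
  f ∈ Lp0 m ν Ω p ∧
    ∀ᵐ x ∂(ν.restrict Ω), IntegrableOn (pFlux p f x) (mClosure m Ω) (m x) ∧
      -∫ y in mClosure m Ω, pFlux p f x y ∂(m x) = g x

/-- The energy `F_{m,p}(f) = (1/2p) ∫_{Ω_m × Ω_m} |∇f|^p d(ν ⊗ m_x) - ∫_Ω f dν`. -/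
def torsionEnergy (m : Kernel X X) (ν : Measure X) (Ω : Set X) (p : ℝ) (f : X → ℝ) : ℝ :=
  1 / (2 * p) * dirichletIntegral m ν Ω p f - ∫ x in Ω, f x ∂ν

end RandomWalkSpace

end

/-! The energy is a convex functional, and solving the Dirichlet problem amounts to minimizing it.

Existence uses no weak compactness. Strict convexity and homogeneity of `|·|^p`, with compactness,
give a uniform convexity inequality for real numbers (`exists_abs_sub_rpow_le`). Integrated, it
passes to `‖∇f‖^p` on the measure `ν ⊗ m` restricted to `Ω_m × Ω_m`. The Poincaré inequality gives
coercivity on the closed subspace `L^p_0`, so minimizing sequences are Cauchy, and the limit is the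
strict minimizer (`exists_strict_minimizer`).

Differentiating the energy at the minimizer gives the weak equation. Reversibility makes the
restricted measure symmetric, which yields integration by parts (`half_integral_flux_mul_nlGrad`)
and hence the equivalence of the weak and the pointwise equation. Conversely, the tangent inequality
for `|·|^p` shows that every weak solution minimizes, so strictness gives uniqueness.

The remaining claims follow from the minimality of `u` and from test functions: `|u|` has no more
energy than `u`, so `u = |u|`; the indicator of `Ω` excludes the solution `0`; `u` tested against
itself gives the energy identity. -/

namespace RandomWalkSpace

/-! ### Convexity inequalities for `|·|^p` on the real line -/

lemma continuous_abs_rpow {p : ℝ} (hp : 0 < p) : Continuous fun x : ℝ => |x| ^ p :=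
  continuous_abs.rpow_const fun _ => Or.inr hp.le

/-- Strict midpoint convexity of `|·|^p`. -/
lemma abs_half_add_rpow_lt {p : ℝ} (hp : 1 < p) {a b : ℝ} (hab : a ≠ b) :
    |(a + b) / 2| ^ p < (|a| ^ p + |b| ^ p) / 2 := by
  -- Strict convexity is available only on `[0, ∞)`, so it separates `a` and `b` only when their
  -- absolute values differ. Otherwise `a = -b` and the midpoint is `0`.
  by_cases h : |a| = |b|
  · rcases abs_eq_abs.1 h with h' | h'
    · exact absurd h' hab
    · have hb : b ≠ 0 := by rintro rfl; exact hab (by simpa using h')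
      have : 0 < |b| ^ p := Real.rpow_pos_of_pos (abs_pos.2 hb) p
      rw [h, h', neg_add_cancel, zero_div, abs_zero, Real.zero_rpow (by linarith)]
      linarith
  · have h1 := (strictConvexOn_rpow hp).2 (Set.mem_Ici.2 (abs_nonneg a))
      (Set.mem_Ici.2 (abs_nonneg b)) h (by norm_num : (0 : ℝ) < 1 / 2)
      (by norm_num : (0 : ℝ) < 1 / 2) (by norm_num)
    simp only [smul_eq_mul] at h1
    have h2 : |(a + b) / 2| ≤ 1 / 2 * |a| + 1 / 2 * |b| := by
      rw [abs_div, abs_two]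
      linarith [abs_add_le a b]
    have h3 := Real.rpow_le_rpow (abs_nonneg _) h2 (by linarith : (0 : ℝ) ≤ p)
    linarith

lemma abs_half_add_rpow_le {p : ℝ} (hp : 1 < p) (a b : ℝ) :
    |(a + b) / 2| ^ p ≤ (|a| ^ p + |b| ^ p) / 2 := by
  rcases eq_or_ne a b with rfl | h
  · simp
  · exact (abs_half_add_rpow_lt hp h).le

lemma abs_sub_rpow_le {p : ℝ} (hp : 1 < p) (a b : ℝ) :
    |a - b| ^ p ≤ 2 ^ p * (|a| ^ p + |b| ^ p) := by
  have h := abs_half_add_rpow_le hp a (-b)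
  have h0 : |a - b| = 2 * |(a + -b) / 2| := by
    rw [abs_div, abs_two, ← sub_eq_add_neg]; ring
  have h1 : 0 ≤ |a| ^ p := by positivity
  have h2 : 0 ≤ |b| ^ p := by positivity
  rw [h0, Real.mul_rpow (by norm_num) (abs_nonneg _)]
  rw [abs_neg] at h
  gcongr
  linarith

/-- Quantitative uniform convexity of `|·|^p`. -/
lemma exists_abs_sub_rpow_le {p : ℝ} (hp : 1 < p) {ε : ℝ} (hε : 0 < ε) :
    ∃ C : ℝ, 0 ≤ C ∧ ∀ a b : ℝ, |a - b| ^ p ≤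
      ε * (|a| ^ p + |b| ^ p) + C * ((|a| ^ p + |b| ^ p) / 2 - |(a + b) / 2| ^ p) := by
  have hp0 : 0 < p := by linarith
  have hc := continuous_abs_rpow hp0
  -- Both sides are homogeneous of degree `p`, so it suffices to treat normalized pairs. Those with
  -- `|a - b|^p ≥ ε` form a compact set off the diagonal, where the convexity deficit has a positive
  -- lower bound `δ`.
  set K : Set (ℝ × ℝ) := {z | |z.1| ^ p + |z.2| ^ p = 1 ∧ ε ≤ |z.1 - z.2| ^ p} with hK
  have hKc : IsCompact K := by
    refine Metric.isCompact_of_isClosed_isBounded ?_ ?_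
    · refine IsClosed.inter ?_ ?_
      · exact isClosed_eq ((hc.comp continuous_fst).add (hc.comp continuous_snd)) continuous_const
      · exact isClosed_le continuous_const (hc.comp (continuous_fst.sub continuous_snd))
    · refine (Metric.isBounded_closedBall (x := (0 : ℝ × ℝ)) (r := 1)).subset ?_
      rintro ⟨a, b⟩ ⟨h1, -⟩
      have ha : 0 ≤ |a| ^ p := by positivity
      have hb : 0 ≤ |b| ^ p := by positivity
      dsimp only at h1
      have key : ∀ t : ℝ, |t| ^ p ≤ 1 → |t| ≤ 1 := fun t ht => by
        by_contra hcon
        push Not at hcon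
        exact absurd ht (not_le.2 (Real.one_lt_rpow hcon hp0))
      rw [mem_closedBall_zero_iff, Prod.norm_def]
      exact max_le (key a (by linarith)) (key b (by linarith))
  obtain ⟨δ, hδ, hKδ⟩ := hKc.exists_forall_le'
    (f := fun z : ℝ × ℝ => (|z.1| ^ p + |z.2| ^ p) / 2 - |(z.1 + z.2) / 2| ^ p) (a := 0)
    (by
      refine Continuous.continuousOn ?_
      exact (((hc.comp continuous_fst).add (hc.comp continuous_snd)).div_const 2).sub
        (hc.comp ((continuous_fst.add continuous_snd).div_const 2)))
    (by
      rintro ⟨a, b⟩ ⟨-, h2⟩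
      have hab : a ≠ b := by
        rintro rfl
        simp only [sub_self, abs_zero, Real.zero_rpow hp0.ne'] at h2
        linarith
      exact sub_pos.2 (abs_half_add_rpow_lt hp hab))
  refine ⟨2 ^ p / δ, by positivity, fun a b => ?_⟩
  set s := |a| ^ p + |b| ^ p with hs
  have hdef := abs_half_add_rpow_le hp a b
  have ha : 0 ≤ |a| ^ p := by positivity
  have hb : 0 ≤ |b| ^ p := by positivity
  have hs0 : 0 ≤ s := by positivity
  have hdef' : 0 ≤ 2 ^ p / δ * (s / 2 - |(a + b) / 2| ^ p) :=
    mul_nonneg (by positivity) (sub_nonneg.2 hdef)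
  -- For close pairs the `ε` term suffices, the deficit being nonnegative. The others are rescaled
  -- by `r = s^(1/p)` into `K`.
  by_cases hsm : |a - b| ^ p ≤ ε * s
  · linarith
  push Not at hsm
  have hspos : 0 < s := by
    rcases hs0.lt_or_eq with h | h
    · exact h
    · exfalso
      have := abs_sub_rpow_le hp a b
      rw [← hs] at this
      rw [← h] at this hsm
      linarith
  set r := s ^ (1 / p) with hr
  have hrpos : 0 < r := Real.rpow_pos_of_pos hspos _
  have hrp : r ^ p = s := by
    rw [hr, ← Real.rpow_mul hs0, one_div_mul_cancel hp0.ne', Real.rpow_one]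
  have hdiv : ∀ t : ℝ, |t / r| ^ p = |t| ^ p / s := fun t => by
    rw [abs_div, abs_of_pos hrpos, Real.div_rpow (abs_nonneg _) hrpos.le, hrp]
  have hmem : (a / r, b / r) ∈ K := by
    constructor
    · simp only [hdiv]
      rw [← add_div, ← hs, div_self hspos.ne']
    · simp only [← sub_div, hdiv]
      rw [le_div_iff₀ hspos]
      exact hsm.le
  have h := hKδ _ hmem
  simp only [hdiv, ← add_div] at h
  rw [div_right_comm (a + b), hdiv, ← hs, div_self hspos.ne'] at h
  have h' : δ * s ≤ s / 2 - |(a + b) / 2| ^ p := by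
    have := mul_le_mul_of_nonneg_right h hs0
    rwa [sub_mul, div_mul_cancel₀ _ hspos.ne', div_mul_eq_mul_div, one_mul] at this
  calc |a - b| ^ p ≤ 2 ^ p * s := abs_sub_rpow_le hp a b
    _ = 2 ^ p / δ * (δ * s) := by field_simp
    _ ≤ 2 ^ p / δ * (s / 2 - |(a + b) / 2| ^ p) := by gcongr
    _ ≤ _ := by nlinarith

/-- A linear function on `[0, ∞)` is dominated by any positive multiple of `t ^ p`, up to a
constant. -/
lemma exists_mul_le_mul_rpow_add {p : ℝ} (hp : 1 < p) {A B : ℝ} (hA : 0 < A) (hB : 0 ≤ B) :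
    ∃ K : ℝ, ∀ t : ℝ, 0 ≤ t → B * t ≤ A * t ^ p + K := by
  -- `T` is where `A * t^p` overtakes `B * t`.
  set T := (B / A) ^ (1 / (p - 1)) with hT
  have hp1 : 0 < p - 1 := by linarith
  have hT0 : 0 ≤ T := by positivity
  refine ⟨B * T, fun t ht => ?_⟩
  rcases le_total t T with h | h
  · have : B * t ≤ B * T := by gcongr
    have : 0 ≤ A * t ^ p := by positivity
    linarith
  · rcases ht.eq_or_lt with rfl | htpos
    · have : 0 ≤ A * (0 : ℝ) ^ p := by positivity
      nlinarith
    have h1 : B / A ≤ t ^ (p - 1) := by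
      calc B / A = T ^ (p - 1) := by
            rw [hT, ← Real.rpow_mul (by positivity), one_div_mul_cancel hp1.ne', Real.rpow_one]
        _ ≤ t ^ (p - 1) := Real.rpow_le_rpow hT0 h hp1.le
    have h2 : t ^ p = t ^ (p - 1) * t := by
      rw [← Real.rpow_add_one htpos.ne', sub_add_cancel]
    rw [div_le_iff₀ hA] at h1
    have : B * t ≤ t ^ (p - 1) * A * t := by gcongr
    have : 0 ≤ B * T := by positivity
    rw [h2]
    linarith

/-! ### The direct method in a Banach space -/

/-- Existence and uniqueness of the minimizer of a coercive, uniformly convex functional with a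
linear perturbation. -/
theorem exists_strict_minimizer {E : Type*} [NormedAddCommGroup E] [NormedSpace ℝ E]
    [CompleteSpace E] {p c a : ℝ} (hp : 1 < p) (hc : 0 < c) (ha : 0 < a) (D : E → ℝ)
    (hD : Continuous D) (hcoer : ∀ f, c * ‖f‖ ^ p ≤ D f)
    (hconv : ∀ ε : ℝ, 0 < ε → ∃ C : ℝ, 0 ≤ C ∧ ∀ f g, D (f - g) ≤
      ε * (D f + D g) + C * ((D f + D g) / 2 - D ((1 / 2 : ℝ) • (f + g))))
    (L : E →L[ℝ] ℝ) :
    ∃ u, ∀ v, v ≠ u → a * D u - L u < a * D v - L v := by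
  have hp0 : 0 < p := by linarith
  set F : E → ℝ := fun f => a * D f - L f with hF
  -- With `A = a * c / 2`, the linear term is absorbed by half of the coercive term, leaving `a / 2
  -- * D f` below `F f + K`.
  obtain ⟨K, hK⟩ := exists_mul_le_mul_rpow_add hp (A := a * c / 2) (by positivity) (norm_nonneg L)
  have hlow : ∀ f, a / 2 * D f ≤ F f + K := fun f => by
    have h1 := hK ‖f‖ (norm_nonneg f)
    have h2 : L f ≤ ‖L‖ * ‖f‖ := (le_abs_self _).trans (L.le_opNorm f)
    have h3 : a / 2 * (c * ‖f‖ ^ p) ≤ a / 2 * D f :=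
      mul_le_mul_of_nonneg_left (hcoer f) (by positivity)
    simp only [hF]
    linarith
  have hD0 : ∀ f, 0 ≤ D f := fun f => le_trans (by positivity) (hcoer f)
  have hbdd : BddBelow (Set.range F) := by
    refine ⟨-K, ?_⟩
    rintro _ ⟨f, rfl⟩
    have := hlow f
    have : 0 ≤ a / 2 * D f := mul_nonneg (by positivity) (hD0 f)
    linarith
  set I := sInf (Set.range F) with hI
  have hIle : ∀ f, I ≤ F f := fun f => csInf_le hbdd ⟨f, rfl⟩
  set B := 2 / a * (|I + 1 + K|) with hB
  have hBnn : 0 ≤ B := by positivity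
  -- Almost-minimizers are close to each other. This one claim gives both the Cauchy property and
  -- uniqueness.
  have hclaim : ∀ η : ℝ, 0 < η → ∃ δ : ℝ, 0 < δ ∧ ∀ f g, F f ≤ I + δ → F g ≤ I + δ →
      ‖f - g‖ < η := by
    intro η hη
    set w := c * η ^ p with hw
    have hwpos : 0 < w := by positivity
    -- Since `D ≤ B` on the relevant sublevel set, this `ε` makes the first term at most `w / 4`;
    -- the `δ` below does the same for the second. The sum is less than `w = c * η^p`. The shifts `B
    -- + 1` and `C + 1` avoid division by zero.
    obtain ⟨C, hC0, hC⟩ := hconv (w / (8 * (B + 1))) (by positivity)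
    refine ⟨min 1 (a * w / (4 * (C + 1))), by positivity, fun f g hf hg => ?_⟩
    set δ := min 1 (a * w / (4 * (C + 1))) with hδ
    have hδ1 : δ ≤ 1 := min_le_left _ _
    have hδ2 : δ ≤ a * w / (4 * (C + 1)) := min_le_right _ _
    have hDB : ∀ f, F f ≤ I + δ → D f ≤ B := fun f hf => by
      have h1 : a / 2 * D f ≤ |I + 1 + K| := by
        have := hlow f
        have := le_abs_self (I + 1 + K)
        linarith
      calc D f = 2 / a * (a / 2 * D f) := by field_simp
        _ ≤ B := by rw [hB]; gcongr
    have h1 := hC f g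
    have h2 := hDB f hf
    have h3 := hDB g hg
    -- `L` cancels in the midpoint deficit of `F`, and the midpoint has energy at least `I`.
    have h4 : a * ((D f + D g) / 2 - D ((1 / 2 : ℝ) • (f + g))) ≤ δ := by
      have := hIle ((1 / 2 : ℝ) • (f + g))
      simp only [hF, map_smul, map_add, smul_eq_mul] at this hf hg
      linarith
    have h5 : C * ((D f + D g) / 2 - D ((1 / 2 : ℝ) • (f + g))) ≤ w / 4 := by
      have e1 : (D f + D g) / 2 - D ((1 / 2 : ℝ) • (f + g)) ≤ w / (4 * (C + 1)) := by
        have := h4.trans hδ2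
        rw [mul_div_assoc] at this
        exact le_of_mul_le_mul_left this ha
      calc _ ≤ C * (w / (4 * (C + 1))) := by gcongr
        _ ≤ (C + 1) * (w / (4 * (C + 1))) := by gcongr; linarith
        _ = w / 4 := by field_simp
    have h6 : w / (8 * (B + 1)) * (D f + D g) ≤ w / 4 := by
      calc _ ≤ w / (8 * (B + 1)) * (2 * (B + 1)) := by gcongr; linarith
        _ = w / 4 := by field_simp; norm_num
    have h7 := hcoer (f - g)
    have h8 : c * ‖f - g‖ ^ p < c * η ^ p := by rw [← hw]; linarith
    exact lt_of_mul_lt_mul_left h8 hc.le |> fun h =>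
      (Real.rpow_lt_rpow_iff (norm_nonneg _) hη.le hp0).1 h
  have hseq : ∀ n : ℕ, ∃ f, F f < I + 1 / ((n : ℝ) + 1) := fun n => by
    obtain ⟨_, ⟨f, rfl⟩, hf⟩ := exists_lt_of_csInf_lt (Set.range_nonempty F)
      (show sInf (Set.range F) < I + 1 / ((n : ℝ) + 1) by
        have : (0 : ℝ) < 1 / ((n : ℝ) + 1) := by positivity
        linarith)
    exact ⟨f, hf⟩
  choose f hf using hseq
  have hcau : CauchySeq f := by
    rw [Metric.cauchySeq_iff']
    intro η hη
    obtain ⟨δ, hδ, h⟩ := hclaim η hη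
    obtain ⟨N, hN⟩ := exists_nat_one_div_lt hδ
    refine ⟨N, fun n hn => ?_⟩
    rw [dist_eq_norm]
    refine h _ _ ?_ ?_
    · have : 1 / ((n : ℝ) + 1) ≤ 1 / ((N : ℝ) + 1) := Nat.one_div_le_one_div hn
      linarith [hf n]
    · linarith [hf N]
  obtain ⟨u, hu⟩ := cauchySeq_tendsto_of_complete hcau
  have hFc : Continuous F := (continuous_const.mul hD).sub L.continuous
  have hFu : F u ≤ I := by
    have h1 := (hFc.tendsto u).comp hu
    have h2 : Filter.Tendsto (fun n : ℕ => I + 1 / ((n : ℝ) + 1)) Filter.atTop (nhds (I + 0)) :=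
      tendsto_const_nhds.add tendsto_one_div_add_atTop_nhds_zero_nat
    rw [add_zero] at h2
    exact le_of_tendsto_of_tendsto' h1 h2 fun n => (hf n).le
  refine ⟨u, fun v hv => ?_⟩
  by_contra hcon
  push Not at hcon
  -- A second minimizer `v` would be nearer to `u` than `‖v - u‖`.
  obtain ⟨δ, hδ, h⟩ := hclaim ‖v - u‖ (norm_pos_iff.2 (sub_ne_zero.2 hv))
  have hFv : F v ≤ I := le_trans hcon hFu
  exact lt_irrefl _ (h v u (by linarith) (by linarith))

/-! ### Algebra of the flux `|a|^(p-2) a` -/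

lemma flux_mul_self (p : ℝ) (hp : p ≠ 0) (a : ℝ) : |a| ^ (p - 2) * a * a = |a| ^ p := by
  rcases eq_or_ne a 0 with rfl | ha
  · simp [Real.zero_rpow hp]
  have ha' : 0 < |a| := abs_pos.2 ha
  rw [mul_assoc, ← abs_mul_abs_self a, ← mul_assoc, ← Real.rpow_add_one ha'.ne',
    ← Real.rpow_add_one ha'.ne']
  congr 1
  ring

/-- The tangent inequality for `|·|^p`. -/
lemma abs_rpow_add_le {p : ℝ} (hp : 1 < p) (a b : ℝ) :
    |a| ^ p + p * (|a| ^ (p - 2) * a * (b - a)) ≤ |b| ^ p := by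
  have hp0 : 0 < p := by linarith
  rcases eq_or_ne a 0 with rfl | ha
  · simp only [abs_zero, Real.zero_rpow hp0.ne', mul_zero, zero_mul, add_zero]
    positivity
  have ha' : 0 < |a| := abs_pos.2 ha
  have h1 := flux_mul_self p hp0.ne' a
  have h2 : |a| ^ (p - 2) * a * b ≤ |a| ^ (p - 1) * |b| := by
    have : |a| ^ (p - 1) = |a| ^ (p - 2) * |a| := by
      rw [← Real.rpow_add_one ha'.ne']; congr 1; ring
    rw [this, mul_assoc, mul_assoc, ← abs_mul]
    gcongr
    exact le_abs_self _
  -- Young's inequality for `|b|` and `|a|^(p-1)`: the conjugate exponent `p / (p - 1)` turns the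
  -- latter into `|a|^p`.
  have h3 := Real.young_inequality_of_nonneg (abs_nonneg b)
    (Real.rpow_nonneg (abs_nonneg a) (p - 1)) (Real.HolderConjugate.conjExponent hp)
  have h4 : (|a| ^ (p - 1)) ^ (p.conjExponent) / p.conjExponent = |a| ^ p * ((p - 1) / p) := by
    have hp1 : p - 1 ≠ 0 := by linarith
    rw [← Real.rpow_mul (abs_nonneg a), Real.conjExponent, mul_div_cancel₀ _ hp1]
    field_simp
  rw [h4] at h3
  have h5 : p * (|b| * |a| ^ (p - 1)) ≤ |b| ^ p + |a| ^ p * (p - 1) := by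
    calc _ ≤ p * (|b| ^ p / p + |a| ^ p * ((p - 1) / p)) := by gcongr
      _ = _ := by field_simp
  have h6 : p * (|a| ^ (p - 2) * a * b) ≤ p * (|a| ^ (p - 1) * |b|) := by gcongr
  have h7 : p * (|a| ^ (p - 2) * a * (b - a)) = p * (|a| ^ (p - 2) * a * b) - p * |a| ^ p := by
    rw [← h1]; ring
  rw [h7]
  linarith

lemma abs_flux {p : ℝ} (hp : 1 < p) (a : ℝ) : |(|a| ^ (p - 2) * a)| = |a| ^ (p - 1) := by
  rcases eq_or_ne a 0 with rfl | ha
  · simp [Real.zero_rpow (by linarith : p - 1 ≠ 0)]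
  · rw [abs_mul, abs_of_nonneg (by positivity), ← Real.rpow_add_one (abs_pos.2 ha).ne']
    congr 1
    ring

/-- The larger of `|a|` and `|b|` replaces the smaller. This crude bound stands in for Hölder's
inequality wherever integrability of a flux is needed. -/
lemma abs_flux_mul_le {p : ℝ} (hp : 1 < p) (a b : ℝ) :
    |(|a| ^ (p - 2) * a) * b| ≤ |a| ^ p + |b| ^ p := by
  have hp0 : 0 < p := by linarith
  have key : ∀ t : ℝ, 0 ≤ t → t ^ (p - 1) * t = t ^ p := fun t ht => by
    rw [← Real.rpow_add_one' ht (by linarith), sub_add_cancel]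
  have h1 : 0 ≤ |a| ^ p := by positivity
  have h2 : 0 ≤ |b| ^ p := by positivity
  rw [abs_mul, abs_flux hp]
  rcases le_total |a| |b| with h | h
  · have : |a| ^ (p - 1) * |b| ≤ |b| ^ (p - 1) * |b| := by
      gcongr
    rw [key _ (abs_nonneg b)] at this
    linarith
  · have : |a| ^ (p - 1) * |b| ≤ |a| ^ (p - 1) * |a| := by gcongr
    rw [key _ (abs_nonneg a)] at this
    linarith

end RandomWalkSpace

noncomputable section

namespace RandomWalkSpace

/-! ### The nonlocal gradient as an operator on `L^q` -/

section Marginals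

variable {X : Type*} [MeasurableSpace X] {μ : Measure X} {κ : Measure (X × X)} {p : ℝ}

/-- Domination of the image measure makes composition with `g` well defined on classes; the next
lemma uses it to see that norms do not increase. For the two projections this controls `f y` and `f
x` in the gradient. -/
lemma quasiMeasurePreserving_of_map_le {Y : Type*} [MeasurableSpace Y] {κ : Measure Y} {g : Y → X}
    (hg : Measurable g) (h : κ.map g ≤ μ) : Measure.QuasiMeasurePreserving g κ μ :=
  ⟨hg, Measure.absolutelyContinuous_of_le h⟩

lemma eLpNorm_comp_le_of_map_le {Y : Type*} [MeasurableSpace Y] {κ : Measure Y} {g : Y → X}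
    (hg : Measurable g) (h : κ.map g ≤ μ) {f : X → ℝ} (hf : AEStronglyMeasurable f μ)
    (q : ENNReal) : eLpNorm (f ∘ g) q κ ≤ eLpNorm f q μ := by
  rw [← eLpNorm_map_measure (hf.mono_measure h) hg.aemeasurable]
  exact eLpNorm_mono_measure f h

lemma memLp_comp_of_map_le {Y : Type*} [MeasurableSpace Y] {κ : Measure Y} {g : Y → X}
    (hg : Measurable g) (h : κ.map g ≤ μ) {f : X → ℝ} {q : ENNReal} (hf : MemLp f q μ) :
    MemLp (f ∘ g) q κ :=
  ⟨hf.1.comp_quasiMeasurePreserving (quasiMeasurePreserving_of_map_le hg h),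
    (eLpNorm_comp_le_of_map_le hg h hf.1 q).trans_lt hf.2⟩

lemma nlGrad_congr (h1 : κ.map Prod.fst ≤ μ) (h2 : κ.map Prod.snd ≤ μ) {f g : X → ℝ}
    (h : f =ᵐ[μ] g) : nlGrad f =ᵐ[κ] nlGrad g := by
  filter_upwards [(quasiMeasurePreserving_of_map_le measurable_fst h1).ae_eq_comp h,
    (quasiMeasurePreserving_of_map_le measurable_snd h2).ae_eq_comp h] with z hz1 hz2
  simp only [Function.comp_apply] at hz1 hz2
  simp only [nlGrad, hz1, hz2]

lemma memLp_nlGrad (h1 : κ.map Prod.fst ≤ μ) (h2 : κ.map Prod.snd ≤ μ) {f : X → ℝ} {q : ENNReal}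
    (hf : MemLp f q μ) : MemLp (nlGrad f) q κ :=
  (memLp_comp_of_map_le measurable_snd h2 hf).sub (memLp_comp_of_map_le measurable_fst h1 hf)

lemma eLpNorm_nlGrad_le (h1 : κ.map Prod.fst ≤ μ) (h2 : κ.map Prod.snd ≤ μ) {f : X → ℝ}
    {q : ENNReal} (hq : 1 ≤ q) (hf : MemLp f q μ) :
    eLpNorm (nlGrad f) q κ ≤ 2 * eLpNorm f q μ := by
  rw [two_mul]
  exact (eLpNorm_sub_le (memLp_comp_of_map_le measurable_snd h2 hf).1
    (memLp_comp_of_map_le measurable_fst h1 hf).1 hq).trans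
    (add_le_add (eLpNorm_comp_le_of_map_le measurable_snd h2 hf.1 q)
      (eLpNorm_comp_le_of_map_le measurable_fst h1 hf.1 q))

/-- The nonlocal gradient as a bounded operator on `L^q`. -/
def gradCLM (h1 : κ.map Prod.fst ≤ μ) (h2 : κ.map Prod.snd ≤ μ) (q : ENNReal)
    [hq : Fact (1 ≤ q)] : Lp ℝ q μ →L[ℝ] Lp ℝ q κ :=
  LinearMap.mkContinuous
    { toFun := fun f => (memLp_nlGrad h1 h2 (Lp.memLp f)).toLp (nlGrad f)
      map_add' := fun f g => by
        rw [← MemLp.toLp_add]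
        refine MemLp.toLp_congr _ _ ((nlGrad_congr h1 h2 (Lp.coeFn_add f g)).trans ?_)
        refine Filter.Eventually.of_forall fun z => ?_
        simp only [nlGrad, Pi.add_apply]
        ring
      map_smul' := fun c f => by
        rw [RingHom.id_apply, ← MemLp.toLp_const_smul]
        refine MemLp.toLp_congr _ _ ((nlGrad_congr h1 h2 (Lp.coeFn_smul c f)).trans ?_)
        refine Filter.Eventually.of_forall fun z => ?_
        simp only [nlGrad, Pi.smul_apply, smul_eq_mul]
        ring }
    2 fun f => by
      simp only [LinearMap.coe_mk, AddHom.coe_mk]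
      rw [Lp.norm_toLp, Lp.norm_def, ← ENNReal.toReal_ofNat, ← ENNReal.toReal_mul]
      exact ENNReal.toReal_mono (ENNReal.mul_ne_top (by simp) (Lp.eLpNorm_ne_top f))
        (eLpNorm_nlGrad_le h1 h2 hq.1 (Lp.memLp f))

lemma gradCLM_coeFn (h1 : κ.map Prod.fst ≤ μ) (h2 : κ.map Prod.snd ≤ μ) (q : ENNReal)
    [Fact (1 ≤ q)] (f : Lp ℝ q μ) : gradCLM h1 h2 q f =ᵐ[κ] nlGrad f :=
  MemLp.coeFn_toLp (memLp_nlGrad h1 h2 (Lp.memLp f))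

end Marginals

/-! ### Integrals of `p`-th powers and their derivatives -/

section PowerIntegrals

variable {Y : Type*} [MeasurableSpace Y] {κ : Measure Y} {p : ℝ}

lemma integrable_abs_rpow (hp : 1 < p) {a : Y → ℝ} (ha : MemLp a (ENNReal.ofReal p) κ) :
    Integrable (fun z => |a z| ^ p) κ := by
  have := ha.integrable_norm_rpow (by simp; linarith) ENNReal.ofReal_ne_top
  simpa [ENNReal.toReal_ofReal (by linarith : 0 ≤ p)] using this

lemma Lp_norm_rpow (hp : 1 < p) (a : Lp ℝ (ENNReal.ofReal p) κ) :
    ‖a‖ ^ p = ∫ z, |a z| ^ p ∂κ := by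
  have hp0 : 0 < p := by linarith
  have h0 : 0 ≤ ∫ z, |a z| ^ p ∂κ := integral_nonneg fun z => by positivity
  rw [Lp.norm_def, (Lp.memLp a).eLpNorm_eq_integral_rpow_norm (by simp; linarith)
    ENNReal.ofReal_ne_top]
  simp only [ENNReal.toReal_ofReal hp0.le, Real.norm_eq_abs]
  rw [ENNReal.toReal_ofReal (by positivity), ← Real.rpow_mul h0, inv_mul_cancel₀ hp0.ne',
    Real.rpow_one]

lemma aestronglyMeasurable_flux {a : Y → ℝ} (ha : AEStronglyMeasurable a κ) :
    AEStronglyMeasurable (fun z => |a z| ^ (p - 2) * a z) κ := by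
  have : Measurable fun t : ℝ => |t| ^ (p - 2) * t := by fun_prop
  exact (this.comp_aemeasurable ha.aemeasurable).aestronglyMeasurable

lemma integrable_flux_mul (hp : 1 < p) {a b : Y → ℝ} (ha : MemLp a (ENNReal.ofReal p) κ)
    (hb : MemLp b (ENNReal.ofReal p) κ) :
    Integrable (fun z => |a z| ^ (p - 2) * a z * b z) κ := by
  refine ((integrable_abs_rpow hp ha).add (integrable_abs_rpow hp hb)).mono'
    ((aestronglyMeasurable_flux ha.1).mul hb.1) (Filter.Eventually.of_forall fun z => ?_)
  exact abs_flux_mul_le hp _ _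

lemma integrable_flux [IsFiniteMeasure κ] (hp : 1 < p) {a : Y → ℝ}
    (ha : MemLp a (ENNReal.ofReal p) κ) : Integrable (fun z => |a z| ^ (p - 2) * a z) κ := by
  simpa using integrable_flux_mul hp ha (memLp_const (1 : ℝ))

lemma hasDerivAt_integral_abs_rpow (hp : 1 < p) {a b : Y → ℝ}
    (ha : MemLp a (ENNReal.ofReal p) κ) (hb : MemLp b (ENNReal.ofReal p) κ) :
    HasDerivAt (fun t : ℝ => ∫ z, |a z + t * b z| ^ p ∂κ)
      (p * ∫ z, |a z| ^ (p - 2) * a z * b z ∂κ) 0 := by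
  have hp0 : 0 < p := by linarith
  have hia := integrable_abs_rpow hp ha
  have hib := integrable_abs_rpow hp hb
  have hab : ∀ t : ℝ, AEStronglyMeasurable (fun z => a z + t * b z) κ :=
    fun t => ha.1.add (hb.1.const_mul t)
  have h := (hasDerivAt_integral_of_dominated_loc_of_deriv_le (μ := κ) (x₀ := (0 : ℝ))
    (s := Metric.ball 0 1)
    (F := fun t z => |a z + t * b z| ^ p)
    (F' := fun t z => p * |a z + t * b z| ^ (p - 2) * (a z + t * b z) * b z)
    -- For `|t| ≤ 1`, the derivative is at most `p * (|a + t b|^p + |b|^p)`, and `|a + t b|^p ≤ 2^p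
    -- * (|a|^p + |b|^p)`.
    (bound := fun z => p * (2 ^ p * (|a z| ^ p + |b z| ^ p) + |b z| ^ p))
    (Metric.ball_mem_nhds _ one_pos)
    (Filter.Eventually.of_forall fun t =>
      (continuous_abs_rpow hp0).comp_aestronglyMeasurable (hab t))
    (by simpa using hia)
    (by
      have := ((aestronglyMeasurable_flux (p := p) (hab 0)).mul hb.1).const_mul p
      refine this.congr (Filter.Eventually.of_forall fun z => ?_)
      simp only [Pi.mul_apply]
      ring)
    (Filter.Eventually.of_forall fun z t ht => by
      have ht1 : |t| ≤ 1 := by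
        rw [mem_ball_zero_iff, Real.norm_eq_abs] at ht
        exact ht.le
      have e1 := abs_flux_mul_le hp (a z + t * b z) (b z)
      have e2 := abs_sub_rpow_le hp (a z) (-(t * b z))
      rw [sub_neg_eq_add, abs_neg] at e2
      have e3 : |t * b z| ^ p ≤ |b z| ^ p := by
        rw [abs_mul]
        refine Real.rpow_le_rpow (by positivity) ?_ hp0.le
        exact mul_le_of_le_one_left (abs_nonneg _) ht1
      have e4 : (2 : ℝ) ^ p * (|a z| ^ p + |t * b z| ^ p) ≤ 2 ^ p * (|a z| ^ p + |b z| ^ p) := by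
        gcongr
      have e5 : p * |a z + t * b z| ^ (p - 2) * (a z + t * b z) * b z =
          p * (|a z + t * b z| ^ (p - 2) * (a z + t * b z) * b z) := by ring
      rw [Real.norm_eq_abs, e5, abs_mul, abs_of_pos hp0]
      gcongr
      linarith)
    ((((hia.add hib).const_mul _).add hib).const_mul _)
    (Filter.Eventually.of_forall fun z t _ => by
      have h1 : HasDerivAt (fun t : ℝ => a z + t * b z) (b z) t := by
        simpa using ((hasDerivAt_id t).mul_const (b z)).const_add (a z)
      exact (hasDerivAt_abs_rpow (a z + t * b z) hp).comp t h1)).2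
  rw [← integral_const_mul]
  refine h.congr_deriv (integral_congr_ae (Filter.Eventually.of_forall fun z => ?_))
  simp only [zero_mul, add_zero]
  ring

end PowerIntegrals

/-! ### The jump measure: symmetry, Fubini and integration by parts -/

section JumpMeasure

variable {X : Type*} [MeasurableSpace X] {m : Kernel X X} {ν : Measure X} {Ω : Set X} {p : ℝ}

lemma measurableSet_mBoundary (hΩ : MeasurableSet Ω) : MeasurableSet (mBoundary m Ω) :=
  hΩ.compl.inter (measurableSet_lt measurable_const (m.measurable_coe hΩ))

lemma measurableSet_mClosure (hΩ : MeasurableSet Ω) : MeasurableSet (mClosure m Ω) :=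
  hΩ.union (measurableSet_mBoundary hΩ)

/-- The measure `d(ν ⊗ m_x)(x, y)` on `Ω_m × Ω_m`. -/
abbrev jumpMeasure (m : Kernel X X) (ν : Measure X) (Ω : Set X) : Measure (X × X) :=
  (ν ⊗ₘ m).restrict (mClosure m Ω ×ˢ mClosure m Ω)

variable [IsMarkovKernel m] [SigmaFinite ν]

lemma jumpMeasure_prod (hΩ : MeasurableSet Ω) {A B : Set X} (hA : MeasurableSet A)
    (hB : MeasurableSet B) : jumpMeasure m ν Ω (A ×ˢ B) =
      ∫⁻ x in A ∩ mClosure m Ω, m x (B ∩ mClosure m Ω) ∂ν := by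
  have hS := measurableSet_mClosure (m := m) hΩ
  rw [Measure.restrict_apply (hA.prod hB), Set.prod_inter_prod,
    Measure.compProd_apply_prod (hA.inter hS) (hB.inter hS)]

lemma map_fst_jumpMeasure_le (hΩ : MeasurableSet Ω) :
    (jumpMeasure m ν Ω).map Prod.fst ≤ ν.restrict (mClosure m Ω) := by
  refine Measure.le_iff.2 fun A hA => ?_
  rw [Measure.map_apply measurable_fst hA, ← Set.prod_univ, jumpMeasure_prod hΩ hA .univ,
    Measure.restrict_apply hA]
  calc _ ≤ ∫⁻ _ in A ∩ mClosure m Ω, 1 ∂ν := lintegral_mono fun x => prob_le_one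
    _ = _ := by simp

lemma isFiniteMeasure_jumpMeasure (hΩ : MeasurableSet Ω) (hfin : ν (mClosure m Ω) < ⊤) :
    IsFiniteMeasure (jumpMeasure m ν Ω) := by
  refine ⟨?_⟩
  have h := map_fst_jumpMeasure_le (m := m) (ν := ν) hΩ Set.univ
  rw [Measure.map_apply measurable_fst .univ, Set.preimage_univ,
    Measure.restrict_apply_univ (mClosure m Ω)] at h
  exact h.trans_lt hfin

/-- Reversibility is symmetry on rectangles, and rectangles determine a finite measure. -/
lemma measurePreserving_swap_jumpMeasure (hrev : m.IsReversible ν) (hΩ : MeasurableSet Ω)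
    (hfin : ν (mClosure m Ω) < ⊤) :
    MeasurePreserving Prod.swap (jumpMeasure m ν Ω) (jumpMeasure m ν Ω) := by
  have := isFiniteMeasure_jumpMeasure hΩ hfin
  have hS := measurableSet_mClosure (m := m) hΩ
  refine ⟨measurable_swap, Measure.ext_prod fun {A B} hA hB => ?_⟩
  rw [Measure.map_apply measurable_swap (hA.prod hB), Set.preimage_swap_prod,
    jumpMeasure_prod hΩ hB hA, jumpMeasure_prod hΩ hA hB]
  exact hrev (hB.inter hS) (hA.inter hS)

lemma map_snd_jumpMeasure_le (hrev : m.IsReversible ν) (hΩ : MeasurableSet Ω)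
    (hfin : ν (mClosure m Ω) < ⊤) :
    (jumpMeasure m ν Ω).map Prod.snd ≤ ν.restrict (mClosure m Ω) := by
  have h := (measurePreserving_swap_jumpMeasure hrev hΩ hfin).map_eq
  have h2 : (Prod.snd : X × X → X) = Prod.fst ∘ Prod.swap := rfl
  rw [h2, ← Measure.map_map measurable_fst measurable_swap, h]
  exact map_fst_jumpMeasure_le hΩ

/-- Restricting to the square amounts to restricting both `ν` and the kernel, so Fubini for
composition products yields integrability of almost every section. -/
lemma jumpMeasure_eq_compProd (hΩ : MeasurableSet Ω) (hfin : ν (mClosure m Ω) < ⊤) :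
    jumpMeasure m ν Ω = (ν.restrict (mClosure m Ω)) ⊗ₘ
      (m.restrict (measurableSet_mClosure (m := m) hΩ)) := by
  have := isFiniteMeasure_jumpMeasure hΩ hfin
  have hS := measurableSet_mClosure (m := m) hΩ
  refine Measure.ext_prod fun {A B} hA hB => ?_
  rw [jumpMeasure_prod hΩ hA hB, Measure.compProd_apply_prod hA hB, Measure.restrict_restrict hA]
  simp_rw [Kernel.restrict_apply, Measure.restrict_apply hB]

/-- Nonlocal integration by parts. -/
lemma half_integral_flux_mul_nlGrad (hrev : m.IsReversible ν) (hΩ : MeasurableSet Ω)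
    (hfin : ν (mClosure m Ω) < ⊤) (hp : 1 < p) {f v : X → ℝ}
    (hf : MemLp f (ENNReal.ofReal p) (ν.restrict (mClosure m Ω)))
    (hv : MemLp v (ENNReal.ofReal p) (ν.restrict (mClosure m Ω))) :
    1 / 2 * ∫ z, |nlGrad f z| ^ (p - 2) * nlGrad f z * nlGrad v z ∂(jumpMeasure m ν Ω) =
      ∫ x in mClosure m Ω, v x * -∫ y in mClosure m Ω, pFlux p f x y ∂(m x) ∂ν := by
  have h1 := map_fst_jumpMeasure_le (m := m) (ν := ν) hΩ
  have h2 := map_snd_jumpMeasure_le hrev hΩ hfin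
  have hg := memLp_nlGrad h1 h2 hf
  have i1 := integrable_flux_mul hp hg (memLp_comp_of_map_le measurable_fst h1 hv)
  have i2 := integrable_flux_mul hp hg (memLp_comp_of_map_le measurable_snd h2 hv)
  have hswap := (measurePreserving_swap_jumpMeasure hrev hΩ hfin).integral_comp
    MeasurableEquiv.prodComm.measurableEmbedding
    (fun z => |nlGrad f z| ^ (p - 2) * nlGrad f z * (v ∘ Prod.snd) z)
  -- The flux is antisymmetric, so exchanging the variables turns the `v y` term into minus the `v
  -- x` term. The two parts of `∇v` contribute equally, which accounts for the factor `1 / 2`.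
  have hanti : ∀ z, |nlGrad f z.swap| ^ (p - 2) * nlGrad f z.swap * (v ∘ Prod.snd) z.swap =
      -(|nlGrad f z| ^ (p - 2) * nlGrad f z * (v ∘ Prod.fst) z) := fun z => by
    have : nlGrad f z.swap = -nlGrad f z := by simp [nlGrad]
    rw [this, abs_neg]
    simp
  simp_rw [hanti] at hswap
  rw [integral_neg] at hswap
  have hsplit : ∫ z, |nlGrad f z| ^ (p - 2) * nlGrad f z * nlGrad v z ∂(jumpMeasure m ν Ω) =
      ∫ z, |nlGrad f z| ^ (p - 2) * nlGrad f z * (v ∘ Prod.snd) z ∂(jumpMeasure m ν Ω) -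
      ∫ z, |nlGrad f z| ^ (p - 2) * nlGrad f z * (v ∘ Prod.fst) z ∂(jumpMeasure m ν Ω) := by
    rw [← integral_sub i2 i1]
    congr 1
    ext z
    simp only [nlGrad, Function.comp_apply]
    ring
  have hfub : ∫ z, |nlGrad f z| ^ (p - 2) * nlGrad f z * (v ∘ Prod.fst) z ∂(jumpMeasure m ν Ω) =
      ∫ x in mClosure m Ω, v x * ∫ y in mClosure m Ω, pFlux p f x y ∂(m x) ∂ν := by
    have hS := measurableSet_mClosure (m := m) hΩ
    rw [Measure.setIntegral_compProd hS hS i1]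
    congr 1
    ext x
    rw [← integral_const_mul]
    congr 1
    ext y
    simp only [pFlux, Function.comp_apply]
    ring
  rw [hsplit, ← hswap, hfub]
  simp_rw [mul_neg]
  rw [integral_neg]
  ring

lemma ae_integrableOn_pFlux (hΩ : MeasurableSet Ω) (hfin : ν (mClosure m Ω) < ⊤)
    (hrev : m.IsReversible ν) (hp : 1 < p) {f : X → ℝ}
    (hf : MemLp f (ENNReal.ofReal p) (ν.restrict (mClosure m Ω))) :
    (∀ᵐ x ∂(ν.restrict (mClosure m Ω)), IntegrableOn (pFlux p f x) (mClosure m Ω) (m x)) ∧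
      IntegrableOn (fun x => ∫ y in mClosure m Ω, pFlux p f x y ∂(m x)) (mClosure m Ω) ν := by
  have h1 := map_fst_jumpMeasure_le (m := m) (ν := ν) hΩ
  have h2 := map_snd_jumpMeasure_le hrev hΩ hfin
  have := isFiniteMeasure_jumpMeasure hΩ hfin
  have hi := integrable_flux hp (memLp_nlGrad h1 h2 hf)
  rw [jumpMeasure_eq_compProd hΩ hfin] at hi
  refine ⟨?_, ?_⟩
  · have h := ((Measure.integrable_compProd_iff hi.1).1 hi).1
    simp only [Kernel.restrict_apply] at h
    exact h
  · have h := Integrable.integral_compProd hi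
    simp only [Kernel.prodMkLeft_apply, Kernel.const_apply, Kernel.restrict_apply] at h
    exact h

end JumpMeasure

end RandomWalkSpace
end

noncomputable section

namespace RandomWalkSpace

/-! ### Uniform convexity of `L^p` and the linear functional -/

section UniformConvexity

variable {Y : Type*} [MeasurableSpace Y] {κ : Measure Y} {p : ℝ}

lemma exists_Lp_norm_sub_rpow_le (hp : 1 < p) {ε : ℝ} (hε : 0 < ε) :
    ∃ C : ℝ, 0 ≤ C ∧ ∀ a b : Lp ℝ (ENNReal.ofReal p) κ, ‖a - b‖ ^ p ≤
      ε * (‖a‖ ^ p + ‖b‖ ^ p) +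
        C * ((‖a‖ ^ p + ‖b‖ ^ p) / 2 - ‖(1 / 2 : ℝ) • (a + b)‖ ^ p) := by
  obtain ⟨C, hC0, hC⟩ := exists_abs_sub_rpow_le hp hε
  refine ⟨C, hC0, fun a b => ?_⟩
  simp only [Lp_norm_rpow hp]
  have ia := integrable_abs_rpow hp (Lp.memLp a)
  have ib := integrable_abs_rpow hp (Lp.memLp b)
  have ic := integrable_abs_rpow hp (Lp.memLp ((1 / 2 : ℝ) • (a + b)))
  have isub := integrable_abs_rpow hp (Lp.memLp (a - b))
  have iab : Integrable (fun z => |a z| ^ p + |b z| ^ p) κ := ia.add ib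
  have idef : Integrable (fun z => (|a z| ^ p + |b z| ^ p) / 2 -
      |((1 / 2 : ℝ) • (a + b) : Lp ℝ (ENNReal.ofReal p) κ) z| ^ p) κ := (iab.div_const 2).sub ic
  rw [← integral_add ia ib, ← integral_div, ← integral_const_mul, ← integral_sub
    (iab.div_const 2) ic, ← integral_const_mul, ← integral_add (iab.const_mul ε) (idef.const_mul C)]
  refine integral_mono_ae isub ((iab.const_mul ε).add (idef.const_mul C)) ?_
  filter_upwards [Lp.coeFn_sub a b, Lp.coeFn_smul (1 / 2 : ℝ) (a + b), Lp.coeFn_add a b]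
    with z h1 h2 h3
  have h := hC (a z) (b z)
  rw [h1, h2]
  simp only [Pi.sub_apply, Pi.smul_apply, h3, Pi.add_apply, smul_eq_mul]
  rw [one_div_mul_eq_div]
  exact h

end UniformConvexity

section SetIntegral

variable {X : Type*} [MeasurableSpace X] {ν : Measure X} {Ω S : Set X}

/-- Integration over a subset as a bounded functional on `L^q` of a finite measure. -/
def setIntegralCLM (hS : ν S < ⊤) (hΩS : Ω ⊆ S) (q : ENNReal) [hq : Fact (1 ≤ q)] :
    Lp ℝ q (ν.restrict S) →L[ℝ] ℝ :=
  have hfin : IsFiniteMeasure (ν.restrict S) := ⟨by rwa [Measure.restrict_apply_univ]⟩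
  have hle : ν.restrict Ω ≤ ν.restrict S := Measure.restrict_mono hΩS le_rfl
  have hint : ∀ f : Lp ℝ q (ν.restrict S), Integrable f (ν.restrict Ω) := fun f =>
    ((Lp.memLp f).integrable hq.1).mono_measure hle
  LinearMap.mkContinuous
    { toFun := fun f => ∫ x in Ω, f x ∂ν
      map_add' := fun f g => by
        rw [← integral_add (hint f) (hint g)]
        exact integral_congr_ae (ae_mono hle (Lp.coeFn_add f g))
      map_smul' := fun c f => by
        rw [RingHom.id_apply, smul_eq_mul, ← integral_const_mul]
        exact integral_congr_ae (ae_mono hle (Lp.coeFn_smul c f)) }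
    -- The Hölder constant `ν(S)^(1 - 1/q)`. For `q = ⊤` the convention `1 / 0 = 0` gives the right
    -- exponent `1`.
    ((ν.restrict S) Set.univ ^ (1 / (1 : ENNReal).toReal - 1 / q.toReal)).toReal fun f => by
      simp only [LinearMap.coe_mk, AddHom.coe_mk]
      have h1 : ‖∫ x in Ω, f x ∂ν‖ ≤ (eLpNorm f 1 (ν.restrict S)).toReal := by
        rw [eLpNorm_one_eq_lintegral_enorm,
          ← integral_norm_eq_lintegral_enorm (Lp.memLp f).1]
        refine (norm_integral_le_integral_norm _).trans ?_
        exact integral_mono_measure hle (Filter.Eventually.of_forall fun _ => norm_nonneg _)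
          ((Lp.memLp f).integrable hq.1).norm
      refine h1.trans ?_
      rw [mul_comm, Lp.norm_def, ← ENNReal.toReal_mul]
      refine ENNReal.toReal_mono (ENNReal.mul_ne_top (Lp.eLpNorm_ne_top f) ?_)
        (eLpNorm_le_eLpNorm_mul_rpow_measure_univ hq.1 (Lp.memLp f).1)
      refine ENNReal.rpow_ne_top_of_nonneg ?_ (measure_ne_top _ _)
      rw [sub_nonneg]
      rcases eq_or_ne q ⊤ with rfl | hqt
      · simp
      · have : (1 : ENNReal).toReal ≤ q.toReal := ENNReal.toReal_mono hqt hq.1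
        exact one_div_le_one_div_of_le (by simp) this

end SetIntegral

/-! ### The torsion problem: minimizers, weak solutions, pointwise solutions -/

section Torsion

variable {X : Type*} [MeasurableSpace X] {m : Kernel X X} {ν : Measure X} {Ω : Set X} {p : ℝ}

lemma mem_Lp0_iff {f : Lp ℝ (ENNReal.ofReal p) (ν.restrict (mClosure m Ω))} :
    f ∈ Lp0 m ν Ω p ↔ ∀ᵐ x ∂(ν.restrict (mBoundary m Ω)), f x = 0 := Iff.rfl

lemma ae_mBoundary {q : X → Prop} (h : ∀ᵐ x ∂(ν.restrict (mClosure m Ω)), q x) :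
    ∀ᵐ x ∂(ν.restrict (mBoundary m Ω)), q x :=
  ae_restrict_of_ae_restrict_of_subset Set.subset_union_right h

lemma ae_domain {q : X → Prop} (h : ∀ᵐ x ∂(ν.restrict (mClosure m Ω)), q x) :
    ∀ᵐ x ∂(ν.restrict Ω), q x :=
  ae_restrict_of_ae_restrict_of_subset Set.subset_union_left h

lemma setIntegral_mClosure_eq (hΩ : MeasurableSet Ω) {h : X → ℝ}
    (h0 : ∀ᵐ x ∂(ν.restrict (mBoundary m Ω)), h x = 0) :
    ∫ x in mClosure m Ω, h x ∂ν = ∫ x in Ω, h x ∂ν := by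
  refine setIntegral_eq_of_subset_of_ae_sdiff_eq_zero
    (measurableSet_mClosure hΩ).nullMeasurableSet Set.subset_union_left ?_
  rw [ae_restrict_iff' (measurableSet_mBoundary hΩ)] at h0
  filter_upwards [h0] with x hx hx'
  exact hx (hx'.1.resolve_left hx'.2)

/-- The space is the kernel of the continuous restriction to `∂_m Ω`. Closedness provides the
completeness that the direct method needs. -/
lemma isClosed_Lp0 [Fact (1 ≤ ENNReal.ofReal p)] :
    IsClosed (Lp0 m ν Ω p : Set (Lp ℝ (ENNReal.ofReal p) (ν.restrict (mClosure m Ω)))) := by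
  set T := LpToLpRestrictCLM X ℝ ℝ (ν.restrict (mClosure m Ω)) (ENNReal.ofReal p) (mBoundary m Ω)
    with hT
  have hres : (ν.restrict (mClosure m Ω)).restrict (mBoundary m Ω) = ν.restrict (mBoundary m Ω) :=
    Measure.restrict_restrict_of_subset Set.subset_union_right
  have heq : (Lp0 m ν Ω p : Set (Lp ℝ (ENNReal.ofReal p) (ν.restrict (mClosure m Ω)))) =
      T ⁻¹' {0} := by
    ext f
    have h1 := LpToLpRestrictCLM_coeFn ℝ (p := ENNReal.ofReal p) (mBoundary m Ω) f
    rw [Set.mem_preimage, Set.mem_singleton_iff, Lp.eq_zero_iff_ae_eq_zero, SetLike.mem_coe,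
      mem_Lp0_iff, ← hres]
    constructor
    · intro h
      filter_upwards [h, h1] with x hx1 hx2
      rw [hT, hx2, hx1, Pi.zero_apply]
    · intro h
      filter_upwards [h, h1] with x hx1 hx2
      rw [← hx2]
      exact hx1
  rw [heq]
  exact isClosed_singleton.preimage T.continuous

lemma integrableOn_domain (hp : 1 < p) (hfin : ν (mClosure m Ω) < ⊤) {f : X → ℝ}
    (hf : MemLp f (ENNReal.ofReal p) (ν.restrict (mClosure m Ω))) : IntegrableOn f Ω ν := by
  have : IsFiniteMeasure (ν.restrict (mClosure m Ω)) := ⟨by rwa [Measure.restrict_apply_univ]⟩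
  exact (hf.integrable (by simpa using hp.le)).mono_measure
    (Measure.restrict_mono Set.subset_union_left le_rfl)

lemma integral_mClosure_mul_eq (hΩ : MeasurableSet Ω)
    {v : Lp ℝ (ENNReal.ofReal p) (ν.restrict (mClosure m Ω))} (hv : v ∈ Lp0 m ν Ω p)
    (q : X → ℝ) : ∫ x in mClosure m Ω, v x * q x ∂ν = ∫ x in Ω, v x * q x ∂ν := by
  refine setIntegral_mClosure_eq hΩ ?_
  filter_upwards [mem_Lp0_iff.1 hv] with x hx
  rw [hx, zero_mul]

variable [IsMarkovKernel m] [SigmaFinite ν]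

lemma dirichletIntegral_congr (hrev : m.IsReversible ν) (hΩ : MeasurableSet Ω)
    (hfin : ν (mClosure m Ω) < ⊤) {f g : X → ℝ} (h : f =ᵐ[ν.restrict (mClosure m Ω)] g) :
    dirichletIntegral m ν Ω p f = dirichletIntegral m ν Ω p g := by
  refine integral_congr_ae ?_
  filter_upwards [nlGrad_congr (map_fst_jumpMeasure_le hΩ) (map_snd_jumpMeasure_le hrev hΩ hfin) h]
    with z hz
  rw [hz]

lemma torsionEnergy_congr (hrev : m.IsReversible ν) (hΩ : MeasurableSet Ω)
    (hfin : ν (mClosure m Ω) < ⊤) {f g : X → ℝ} (h : f =ᵐ[ν.restrict (mClosure m Ω)] g) :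
    torsionEnergy m ν Ω p f = torsionEnergy m ν Ω p g := by
  rw [torsionEnergy, torsionEnergy, dirichletIntegral_congr hrev hΩ hfin h,
    integral_congr_ae (ae_domain h)]

/-- Existence of a strict minimizer of the torsion energy. -/
theorem exists_torsionEnergy_minimizer (hrev : m.IsReversible ν) (hΩ : MeasurableSet Ω)
    (hfin : ν (mClosure m Ω) < ⊤) (hp : 1 < p) (hP : PoincareInequality m ν Ω p) :
    ∃ u ∈ Lp0 m ν Ω p, ∀ v ∈ Lp0 m ν Ω p, v ≠ u →
      torsionEnergy m ν Ω p u < torsionEnergy m ν Ω p v := by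
  have : Fact (1 ≤ ENNReal.ofReal p) := ⟨by simpa using hp.le⟩
  have : CompleteSpace (Lp0 m ν Ω p) := (isClosed_Lp0 (m := m) (ν := ν)).completeSpace_coe
  have hp0 : 0 < p := by linarith
  set G := gradCLM (map_fst_jumpMeasure_le (m := m) (ν := ν) hΩ)
    (map_snd_jumpMeasure_le hrev hΩ hfin) (ENNReal.ofReal p)
  have hG : ∀ f, ‖G f‖ ^ p = dirichletIntegral m ν Ω p f := fun f => by
    rw [Lp_norm_rpow hp]
    refine integral_congr_ae ?_
    filter_upwards [gradCLM_coeFn (map_fst_jumpMeasure_le (m := m) (ν := ν) hΩ)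
      (map_snd_jumpMeasure_le hrev hΩ hfin) (ENNReal.ofReal p) f] with z hz
    rw [hz]
  obtain ⟨c, hc, hcP⟩ := hP
  obtain ⟨u, hu⟩ := exists_strict_minimizer (E := Lp0 m ν Ω p) hp hc
    (a := 1 / (2 * p)) (by positivity) (fun f => ‖G f‖ ^ p)
    ((G.continuous.comp continuous_subtype_val).norm.rpow_const fun _ => Or.inr hp0.le)
    (fun f => by
      simp only [hG]
      refine le_trans (le_of_eq ?_) (hcP f f.2)
      -- The Poincaré inequality bounds only the integral over `Ω`; vanishing on `∂_m Ω` makes this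
      -- the full norm on `Ω_m`.
      rw [Submodule.coe_norm, Lp_norm_rpow hp, setIntegral_mClosure_eq hΩ]
      filter_upwards [mem_Lp0_iff.1 f.2] with x hx
      rw [hx, abs_zero, Real.zero_rpow hp0.ne'])
    (fun ε hε => by
      obtain ⟨C, hC0, hC⟩ := exists_Lp_norm_sub_rpow_le (κ := jumpMeasure m ν Ω) hp hε
      refine ⟨C, hC0, fun f g => ?_⟩
      simpa using hC (G f) (G g))
    ((setIntegralCLM hfin Set.subset_union_left (ENNReal.ofReal p)).comp (Lp0 m ν Ω p).subtypeL)
  refine ⟨u, u.2, fun v hv hvu => ?_⟩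
  have h := hu ⟨v, hv⟩ fun h => hvu (congrArg Subtype.val h)
  simp only [hG, ContinuousLinearMap.comp_apply, Submodule.subtypeL_apply] at h
  exact h

/-- The weak form of the Dirichlet problem with right-hand side `1`. -/
def IsWeakSolution (m : Kernel X X) (ν : Measure X) (Ω : Set X) (p : ℝ) (f : X → ℝ) : Prop :=
  ∀ v ∈ Lp0 m ν Ω p,
    1 / 2 * ∫ z, |nlGrad f z| ^ (p - 2) * nlGrad f z * nlGrad v z ∂(jumpMeasure m ν Ω) =
      ∫ x in Ω, v x ∂ν

/-- Along each line `u + t v` in `L^p_0` the energy is minimal at `t = 0`, so its derivative there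
vanishes. The normalization `1 / (2p)` leaves the factor `1 / 2`. -/
lemma isWeakSolution_of_minimizer (hrev : m.IsReversible ν) (hΩ : MeasurableSet Ω)
    (hfin : ν (mClosure m Ω) < ⊤) (hp : 1 < p)
    {u : Lp ℝ (ENNReal.ofReal p) (ν.restrict (mClosure m Ω))} (hu : u ∈ Lp0 m ν Ω p)
    (hmin : ∀ v ∈ Lp0 m ν Ω p, torsionEnergy m ν Ω p u ≤ torsionEnergy m ν Ω p v) :
    IsWeakSolution m ν Ω p u := by
  intro v hv
  have h1 := map_fst_jumpMeasure_le (m := m) (ν := ν) hΩ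
  have h2 := map_snd_jumpMeasure_le hrev hΩ hfin
  have iu := integrableOn_domain hp hfin (Lp.memLp u)
  have iv := integrableOn_domain hp hfin (Lp.memLp v)
  have hE : ∀ t : ℝ, torsionEnergy m ν Ω p ↑(u + t • v) =
      1 / (2 * p) * ∫ z, |nlGrad u z + t * nlGrad v z| ^ p ∂(jumpMeasure m ν Ω) -
        ((∫ x in Ω, u x ∂ν) + t * ∫ x in Ω, v x ∂ν) := fun t => by
    have hae : (↑(u + t • v) : X → ℝ) =ᵐ[ν.restrict (mClosure m Ω)] fun x => u x + t * v x := by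
      filter_upwards [Lp.coeFn_add u (t • v), Lp.coeFn_smul t v] with x hx1 hx2
      rw [hx1, Pi.add_apply, hx2, Pi.smul_apply, smul_eq_mul]
    rw [torsionEnergy_congr hrev hΩ hfin hae, torsionEnergy, dirichletIntegral,
      integral_add iu (iv.const_mul t), integral_const_mul]
    congr 3
    ext z
    simp only [nlGrad]
    congr 2
    ring
  have hder := ((hasDerivAt_integral_abs_rpow hp (memLp_nlGrad h1 h2 (Lp.memLp u))
    (memLp_nlGrad h1 h2 (Lp.memLp v))).const_mul (1 / (2 * p))).sub
    (((hasDerivAt_id (0 : ℝ)).mul_const (∫ x in Ω, v x ∂ν)).const_add (∫ x in Ω, u x ∂ν))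
  have hloc : IsLocalMin (fun t : ℝ =>
      1 / (2 * p) * ∫ z, |nlGrad u z + t * nlGrad v z| ^ p ∂(jumpMeasure m ν Ω) -
        ((∫ x in Ω, u x ∂ν) + t * ∫ x in Ω, v x ∂ν)) 0 := by
    refine Filter.Eventually.of_forall fun t => ?_
    simp only [← hE]
    rw [zero_smul, add_zero]
    exact hmin _ (add_mem hu (Submodule.smul_mem _ t hv))
  have h := hloc.hasDerivAt_eq_zero hder
  have hpp : 1 / (2 * p) * (p * ∫ z, |nlGrad u z| ^ (p - 2) * nlGrad u z * nlGrad v z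
      ∂(jumpMeasure m ν Ω)) = 1 / 2 * ∫ z, |nlGrad u z| ^ (p - 2) * nlGrad u z * nlGrad v z
      ∂(jumpMeasure m ν Ω) := by
    have : p ≠ 0 := by linarith
    field_simp
  rw [hpp] at h
  linarith

/-- By convexity critical points are global minimizers: the tangent inequality at `∇g` is
integrated, and the weak equation tested with `w` and `g` evaluates the linear term. -/
lemma IsWeakSolution.torsionEnergy_le (hrev : m.IsReversible ν) (hΩ : MeasurableSet Ω)
    (hfin : ν (mClosure m Ω) < ⊤) (hp : 1 < p)
    {g : Lp ℝ (ENNReal.ofReal p) (ν.restrict (mClosure m Ω))} (hg : g ∈ Lp0 m ν Ω p)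
    (hweak : IsWeakSolution m ν Ω p g)
    {w : Lp ℝ (ENNReal.ofReal p) (ν.restrict (mClosure m Ω))} (hw : w ∈ Lp0 m ν Ω p) :
    torsionEnergy m ν Ω p g ≤ torsionEnergy m ν Ω p w := by
  have hp0 : 0 < p := by linarith
  have h1 := map_fst_jumpMeasure_le (m := m) (ν := ν) hΩ
  have h2 := map_snd_jumpMeasure_le hrev hΩ hfin
  have mg := memLp_nlGrad h1 h2 (Lp.memLp g)
  have mw := memLp_nlGrad h1 h2 (Lp.memLp w)
  have iflux := integrable_flux_mul hp mg (mw.sub mg)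
  have hkey : dirichletIntegral m ν Ω p g + p * ∫ z, |nlGrad g z| ^ (p - 2) * nlGrad g z *
      (nlGrad w - nlGrad g) z ∂(jumpMeasure m ν Ω) ≤ dirichletIntegral m ν Ω p w := by
    rw [dirichletIntegral, dirichletIntegral, ← integral_const_mul,
      ← integral_add (integrable_abs_rpow hp mg) (iflux.const_mul p)]
    exact integral_mono ((integrable_abs_rpow hp mg).add (iflux.const_mul p))
      (integrable_abs_rpow hp mw) fun z => abs_rpow_add_le hp _ _
  have hww := hweak w hw
  have hwg := hweak g hg
  have hsub : ∫ z, |nlGrad g z| ^ (p - 2) * nlGrad g z * (nlGrad w - nlGrad g) z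
      ∂(jumpMeasure m ν Ω) = 2 * ((∫ x in Ω, w x ∂ν) - ∫ x in Ω, g x ∂ν) := by
    simp only [Pi.sub_apply, mul_sub]
    rw [integral_sub (integrable_flux_mul hp mg mw) (integrable_flux_mul hp mg mg)]
    linarith
  rw [hsub] at hkey
  have := mul_le_mul_of_nonneg_left hkey (by positivity : 0 ≤ 1 / (2 * p))
  have e : 1 / (2 * p) * (dirichletIntegral m ν Ω p g +
      p * (2 * ((∫ x in Ω, w x ∂ν) - ∫ x in Ω, g x ∂ν))) =
      1 / (2 * p) * dirichletIntegral m ν Ω p g +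
        ((∫ x in Ω, w x ∂ν) - ∫ x in Ω, g x ∂ν) := by field_simp
  rw [e] at this
  rw [torsionEnergy, torsionEnergy]
  linarith

lemma IsDirichletSolution.isWeakSolution (hrev : m.IsReversible ν) (hΩ : MeasurableSet Ω)
    (hfin : ν (mClosure m Ω) < ⊤) (hp : 1 < p)
    {g : Lp ℝ (ENNReal.ofReal p) (ν.restrict (mClosure m Ω))}
    (hg : IsDirichletSolution m ν Ω p (fun _ => 1) g) : IsWeakSolution m ν Ω p g := by
  intro v hv
  rw [half_integral_flux_mul_nlGrad hrev hΩ hfin hp (Lp.memLp g) (Lp.memLp v),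
    integral_mClosure_mul_eq hΩ hv]
  refine integral_congr_ae ?_
  filter_upwards [hg.2] with x hx
  rw [hx.2, mul_one]

lemma IsWeakSolution.isDirichletSolution (hrev : m.IsReversible ν) (hΩ : MeasurableSet Ω)
    (hfin : ν (mClosure m Ω) < ⊤) (hp : 1 < p)
    {u : Lp ℝ (ENNReal.ofReal p) (ν.restrict (mClosure m Ω))} (hu : u ∈ Lp0 m ν Ω p)
    (hweak : IsWeakSolution m ν Ω p u) : IsDirichletSolution m ν Ω p (fun _ => 1) u := by
  have hS := measurableSet_mClosure (m := m) hΩ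
  have : IsFiniteMeasure (ν.restrict (mClosure m Ω)) := ⟨by rwa [Measure.restrict_apply_univ]⟩
  have : IsFiniteMeasure (ν.restrict Ω) :=
    ⟨by
      rw [Measure.restrict_apply_univ]
      exact (measure_mono Set.subset_union_left).trans_lt hfin⟩
  obtain ⟨hint, hq⟩ := ae_integrableOn_pFlux hΩ hfin hrev hp (Lp.memLp u)
  have hq' : IntegrableOn (fun x => ∫ y in mClosure m Ω, pFlux p u x y ∂(m x)) Ω ν :=
    hq.mono_set Set.subset_union_left
  have hae : (fun x => -∫ y in mClosure m Ω, pFlux p u x y ∂(m x)) =ᵐ[ν.restrict Ω]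
      fun _ => (1 : ℝ) := by
    refine Integrable.ae_eq_of_forall_setIntegral_eq _ _ hq'.neg (integrable_const _) ?_
    intro A hA _
    have hAΩ : MeasurableSet (A ∩ Ω) := hA.inter hΩ
    -- Indicators of `A ∩ Ω` vanish on `∂_m Ω`, hence are admissible. They show that both sides of
    -- the equation have equal integrals over every measurable part of `Ω`.
    set v := indicatorConstLp (μ := ν.restrict (mClosure m Ω)) (ENNReal.ofReal p) hAΩ
      (measure_ne_top _ _) (1 : ℝ) with hvdef
    have hvae : v =ᵐ[ν.restrict (mClosure m Ω)] (A ∩ Ω).indicator fun _ => (1 : ℝ) :=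
      indicatorConstLp_coeFn
    have hv : v ∈ Lp0 m ν Ω p := by
      rw [mem_Lp0_iff]
      filter_upwards [ae_mBoundary hvae, ae_restrict_mem (measurableSet_mBoundary hΩ)]
        with x hx hx'
      rw [hx, Set.indicator_of_notMem fun h => hx'.1 h.2]
    have h := hweak v hv
    rw [half_integral_flux_mul_nlGrad hrev hΩ hfin hp (Lp.memLp u) (Lp.memLp v),
      integral_mClosure_mul_eq hΩ hv] at h
    have e : ∀ k : X → ℝ, ∫ x in A, k x ∂(ν.restrict Ω) = ∫ x in Ω, v x * k x ∂ν := fun k => by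
      rw [← integral_indicator hA]
      refine integral_congr_ae ?_
      filter_upwards [ae_domain hvae, ae_restrict_mem hΩ] with x hx hx'
      rw [hx]
      by_cases hxA : x ∈ A
      · rw [Set.indicator_of_mem hxA, Set.indicator_of_mem (show x ∈ A ∩ Ω from ⟨hxA, hx'⟩), one_mul]
      · rw [Set.indicator_of_notMem hxA, Set.indicator_of_notMem fun h => hxA h.1, zero_mul]
    rw [e, e, h]
    simp only [mul_one]
  refine ⟨hu, ?_⟩
  filter_upwards [hae, ae_domain hint] with x hx1 hx2
  exact ⟨hx2, hx1⟩

/-- Since `||a| - |b|| ≤ |a - b|`, the Dirichlet integral does not grow, while the subtracted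
integral does not decrease. -/
lemma torsionEnergy_abs_le (hrev : m.IsReversible ν) (hΩ : MeasurableSet Ω)
    (hfin : ν (mClosure m Ω) < ⊤) (hp : 1 < p)
    (u : Lp ℝ (ENNReal.ofReal p) (ν.restrict (mClosure m Ω))) :
    torsionEnergy m ν Ω p ↑|u| ≤ torsionEnergy m ν Ω p u := by
  have hp0 : 0 < p := by linarith
  have h1 := map_fst_jumpMeasure_le (m := m) (ν := ν) hΩ
  have h2 := map_snd_jumpMeasure_le hrev hΩ hfin
  rw [torsionEnergy_congr hrev hΩ hfin (Lp.coeFn_abs u), torsionEnergy, torsionEnergy]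
  have iu := integrableOn_domain hp hfin (Lp.memLp u)
  have hD : dirichletIntegral m ν Ω p (fun x => |u x|) ≤ dirichletIntegral m ν Ω p u := by
    refine integral_mono (integrable_abs_rpow hp (memLp_nlGrad h1 h2 (Lp.memLp u).abs))
      (integrable_abs_rpow hp (memLp_nlGrad h1 h2 (Lp.memLp u))) fun z => ?_
    exact Real.rpow_le_rpow (abs_nonneg _) (abs_abs_sub_abs_le _ _) hp0.le
  have hL : ∫ x in Ω, u x ∂ν ≤ ∫ x in Ω, |u x| ∂ν :=
    integral_mono iu iu.abs fun x => le_abs_self _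
  have := mul_le_mul_of_nonneg_left hD (by positivity : 0 ≤ 1 / (2 * p))
  linarith

/-- Testing the weak equation for `0` with the indicator of `Ω` would give `0 = ν Ω`. -/
lemma not_isDirichletSolution_zero (hrev : m.IsReversible ν) (hΩ : MeasurableSet Ω)
    (hfin : ν (mClosure m Ω) < ⊤) (hΩ_pos : 0 < ν Ω) (hp : 1 < p) :
    ¬ IsDirichletSolution m ν Ω p (fun _ => 1) 0 := by
  intro h
  have : Fact (1 ≤ ENNReal.ofReal p) := ⟨by simpa using hp.le⟩
  have hweak := h.isWeakSolution hrev hΩ hfin hp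
  have hΩfin : ν Ω ≠ ⊤ := ((measure_mono Set.subset_union_left).trans_lt hfin).ne
  set v := indicatorConstLp (μ := ν.restrict (mClosure m Ω)) (ENNReal.ofReal p) hΩ
    (by
      rw [Measure.restrict_apply hΩ]
      exact measure_ne_top_of_subset Set.inter_subset_left hΩfin) (1 : ℝ)
  have hvae : v =ᵐ[ν.restrict (mClosure m Ω)] Ω.indicator fun _ => (1 : ℝ) :=
    indicatorConstLp_coeFn
  have hv : v ∈ Lp0 m ν Ω p := by
    rw [mem_Lp0_iff]
    filter_upwards [ae_mBoundary hvae, ae_restrict_mem (measurableSet_mBoundary hΩ)] with x hx hx'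
    rw [hx, Set.indicator_of_notMem hx'.1]
  have e := hweak v hv
  have h0 : nlGrad (0 : Lp ℝ (ENNReal.ofReal p) (ν.restrict (mClosure m Ω)))
      =ᵐ[jumpMeasure m ν Ω] nlGrad 0 :=
    nlGrad_congr (map_fst_jumpMeasure_le hΩ) (map_snd_jumpMeasure_le hrev hΩ hfin)
      (Lp.coeFn_zero _ _ _)
  have e0 : ∫ z, |nlGrad (0 : Lp ℝ (ENNReal.ofReal p) (ν.restrict (mClosure m Ω))) z| ^ (p - 2) *
      nlGrad (0 : Lp ℝ (ENNReal.ofReal p) (ν.restrict (mClosure m Ω))) z * nlGrad v z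
      ∂(jumpMeasure m ν Ω) = 0 := by
    refine integral_eq_zero_of_ae ?_
    filter_upwards [h0] with z hz
    rw [hz]
    simp [nlGrad]
  have e1 : ∫ x in Ω, v x ∂ν = ν.real Ω := by
    rw [integral_congr_ae (ae_domain hvae), setIntegral_indicator hΩ]
    simp
  rw [e0, e1, mul_zero] at e
  exact (ENNReal.toReal_pos hΩ_pos.ne' hΩfin).ne e

end Torsion

end RandomWalkSpace
end

open RandomWalkSpace
theorem mainTheorem7 {X : Type*} [MeasurableSpace X] [MeasurableSpace.CountablyGenerated X]
    (m : Kernel X X) [IsMarkovKernel m] (ν : Measure X) [SigmaFinite ν]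
    (hrev : m.IsReversible ν)
    (Ω : Set X) (hΩ : MeasurableSet Ω) (hΩ_pos : 0 < ν Ω)
    (hΩ_lt : ν Ω < ν (RandomWalkSpace.mClosure m Ω))
    (hΩ_fin : ν (RandomWalkSpace.mClosure m Ω) < ⊤)
    (p : ℝ) (hp : 1 < p) (hP : RandomWalkSpace.PoincareInequality m ν Ω p) :
    -- both integrals in the energy are finite on the whole space `L^p_0(Ω_m, ν)`
    (∀ f ∈ RandomWalkSpace.Lp0 m ν Ω p,
      IntegrableOn (fun z => |RandomWalkSpace.nlGrad f z| ^ p)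
        (RandomWalkSpace.mClosure m Ω ×ˢ RandomWalkSpace.mClosure m Ω) (ν ⊗ₘ m) ∧
      IntegrableOn f Ω ν) ∧
    ∃ f : Lp ℝ (ENNReal.ofReal p) (ν.restrict (RandomWalkSpace.mClosure m Ω)),
      -- `f` is the unique solution, and it is nonnegative
      RandomWalkSpace.IsDirichletSolution m ν Ω p (fun _ => 1) f ∧
      (∀ g, RandomWalkSpace.IsDirichletSolution m ν Ω p (fun _ => 1) g → g = f) ∧
      0 ≤ f ∧
      -- `f` is the unique minimizer of the energy, both in `L^p_0` and in `L^p_0 \ {0}`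
      f ≠ 0 ∧
      (∀ g ∈ RandomWalkSpace.Lp0 m ν Ω p, g ≠ f →
        RandomWalkSpace.torsionEnergy m ν Ω p f < RandomWalkSpace.torsionEnergy m ν Ω p g) ∧
      -- the energy identity
      ∫ x in Ω, f x ∂ν = 1 / 2 * RandomWalkSpace.dirichletIntegral m ν Ω p f := by

  have hp0 : 0 < p := by linarith
  have h1 := map_fst_jumpMeasure_le (m := m) (ν := ν) hΩ
  have h2 := map_snd_jumpMeasure_le hrev hΩ hΩ_fin
  refine ⟨fun f _ => ⟨integrable_abs_rpow hp (memLp_nlGrad h1 h2 (Lp.memLp f)),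
    integrableOn_domain hp hΩ_fin (Lp.memLp f)⟩, ?_⟩
  obtain ⟨u, hu, hmin⟩ := exists_torsionEnergy_minimizer hrev hΩ hΩ_fin hp hP
  have hmin' : ∀ v ∈ Lp0 m ν Ω p, torsionEnergy m ν Ω p u ≤ torsionEnergy m ν Ω p v := by
    intro v hv
    rcases eq_or_ne v u with rfl | h
    · exact le_rfl
    · exact (hmin v hv h).le
  have hweak := isWeakSolution_of_minimizer hrev hΩ hΩ_fin hp hu hmin'
  have hsol := hweak.isDirichletSolution hrev hΩ hΩ_fin hp hu
  refine ⟨u, hsol, fun g hg => ?_, ?_, ?_, hmin, ?_⟩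
  · by_contra hne
    exact absurd ((hg.isWeakSolution hrev hΩ hΩ_fin hp).torsionEnergy_le hrev hΩ hΩ_fin hp hg.1 hu)
      (not_le.2 (hmin g hg.1 hne))
  · have habs : |u| ∈ Lp0 m ν Ω p := by
      rw [mem_Lp0_iff]
      filter_upwards [ae_mBoundary (Lp.coeFn_abs u), mem_Lp0_iff.1 hu] with x hx1 hx2
      rw [hx1, hx2, abs_zero]
    have : |u| = u := by
      by_contra hne
      exact absurd (torsionEnergy_abs_le hrev hΩ hΩ_fin hp u) (not_le.2 (hmin _ habs hne))
    rw [← this]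
    exact abs_nonneg u
  · rintro rfl
    exact not_isDirichletSolution_zero hrev hΩ hΩ_fin hΩ_pos hp hsol
  -- The weak equation is tested with the solution itself, and the flux times `∇u` is `|∇u|^p`.
  · rw [← hweak u hu, dirichletIntegral]
    simp only [flux_mul_self p hp0.ne']
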